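/- **Definitions.** For an integer $i\ge 1$ let $\mathcal R_i$ be the class of functions $\rho\colon[0,1]\to\mathbb R$ with $\rho(0)=0$ and $\rho(t)=t^{\alpha}L(1/t)$ for $t\in(0,1]$, where $\alpha>0$, the function $L\colon[1,\infty)\to(0,\infty)$ is continuous and normalized slowly varying at infinity (that is, for some $b\ge1$, $c>0$ and some locally integrable $\eta$ with $\eta(u)\to0$ as $u\to\infty$, one has $L(x)=c\exp\big(\int_b^x\eta(u)\,\frac{du}{u}\big)$ for all $x\ge b$), $\rho$ is non-decreasing on $[0,1]$, and $$\lim_{\delta\to0^+}\rho(\delta)\,\delta^{-1/2}\,(\ln(\delta^{-1}))^{-i/2}=+\infty .$$ (The last condition forces $\alpha\le 1/2$.) For $\rho\in\mathcal R_i$ let $\mathcal H_\rho^o$ be the space of functions $x\colon[0,1]\to\mathbb R$ with $$\lim_{\delta\to0}\ \sup_{s,t\in[0,1],\,0<t-s<\delta}\frac{|x(t)-x(s)|}{\rho(t-s)}=0,$$ equipped with the norm $\|x\|_\rho=\sup_{0\le s<t\le1}\frac{|x(t)-x(s)|}{\rho(t-s)}+|x(0)|$ and its Borel $\sigma$-algebra.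 **Proposition.** Let $(X_j)_{j\ge1}$ be an arbitrary (not necessarily stationary or independent) sequence of real random variables on a probability space, and let $S_N=\sum_{j=1}^N X_j$. Let $(a_n)_{n\ge1}$ be a non-decreasing sequence of non-zero real numbers with $a_n\to+\infty$ and $\sup_{n\ge1}a_{2n}/a_n<\infty$. For $n\ge1$ and $t\in[0,1]$ let $$W_n(t)=\frac1{a_n}\Big(\sum_{j=1}^{[nt]}X_j+(nt-[nt])X_{[nt]+1}\Big),$$ where $[\cdot]$ is the integer part. Let $\rho\in\mathcal R_i$ for some $i\ge1$. Suppose that for every $\varepsilon>0$ $$\lim_{J\to\infty}\limsup_{n\to\infty}\sum_{j=J}^{[\log_2 n]}\sum_{k=0}^{2^j-1}\mathbb P\Big\{\big|S_{[n(k+1)2^{-j}]}-S_{[nk2^{-j}]}\big|>a_n\,\varepsilon\,\rho(2^{-j})\Big\}=0 .$$ Then every $W_n$, $n\ge1$, is a random element of $\mathcal H_\rho^o$, and the sequence $(W_n)_{n\ge1}$ is tight in $\mathcal H_\rho^o$: for every $\eta>0$ there is a compact set $K\subset\mathcal H_\rho^o$ with $\mathbb P\{W_n\notin K\}\le\eta$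 for all $n\ge1$. -/

import Mathlib

open MeasureTheory Filter Topology

/-- `L : [1, ∞) → ℝ` (only the values on `[1, ∞)` matter) is normalized slowly varying at infinity:
for some `b ≥ 1`, `c > 0` and some locally integrable `η` with `η u → 0` as `u → ∞`,
`L x = c * exp (∫ u in b..x, η u / u)` for all `x ≥ b`. -/
def NormalizedSlowlyVarying (L : ℝ → ℝ) : Prop :=
  ∃ (b c : ℝ) (η : ℝ → ℝ), 1 ≤ b ∧ 0 < c ∧ Tendsto η atTop (𝓝 0) ∧
    (∀ x, b ≤ x → IntervalIntegrable η volume b x) ∧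
    ∀ x, b ≤ x → L x = c * Real.exp (∫ u in b..x, η u / u)

/-- The class `R_i` of moduli of regularity on `[0, 1]`; values outside `[0, 1]` are irrelevant, and
the expression `t ^ α * L (1 / t)` is read as its limit `0` at `t = 0`.
The growth condition forces `α ≤ 1 / 2`. -/
def RClass (i : ℕ) : Set (ℝ → ℝ) :=
  {ρ | (∃ (α : ℝ) (L : ℝ → ℝ), 0 < α ∧
          NormalizedSlowlyVarying L ∧ (∀ u, 1 ≤ u → 0 < L u) ∧ ContinuousOn L (Set.Ici 1) ∧
          ρ 0 = 0 ∧ ∀ t, 0 < t → t ≤ 1 → ρ t = t ^ α * L (1 / t)) ∧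
       MonotoneOn ρ (Set.Icc 0 1) ∧
       Tendsto (fun δ : ℝ => ρ δ * δ ^ (-(1 / 2) : ℝ) * Real.log δ⁻¹ ^ (-(i : ℝ) / 2))
         (𝓝[>] 0) atTop}

lemma RClass.pos {i : ℕ} (ρ : RClass i) {t : ℝ} (h0 : 0 < t) (h1 : t ≤ 1) : 0 < ρ.1 t := by
  obtain ⟨⟨α, L, -, -, hL, -, -, h⟩, -⟩ := ρ.2
  rw [h t h0 h1]
  exact mul_pos (Real.rpow_pos_of_pos h0 _) (hL _ (by rw [le_div_iff₀ h0]; linarith))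

/-- `lim_{δ → 0} sup_{0 < t - s < δ} |x t - x s| / ρ (t - s) = 0`, written out. -/
def IsLittleHolder (ρ : ℝ → ℝ) (x : unitInterval → ℝ) : Prop :=
  ∀ ε : ℝ, 0 < ε → ∃ δ : ℝ, 0 < δ ∧ ∀ s t : unitInterval, s < t → (t : ℝ) - s < δ →
    |x t - x s| / ρ (t - s) ≤ ε

lemma RClass.pos_sub {i : ℕ} (ρ : RClass i) {s t : unitInterval} (h : s < t) :
    0 < ρ.1 ((t : ℝ) - s) := by
  have h' : (s : ℝ) < t := h
  exact RClass.pos ρ (by linarith) (by linarith [t.2.2, s.2.1])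

/-- The vector space of the functions `x : [0, 1] → ℝ` that are `o(ρ)`-Hölder. -/
def littleHolderSubmodule {i : ℕ} (ρ : RClass i) : Submodule ℝ (unitInterval → ℝ) where
  carrier := {x | IsLittleHolder ρ.1 x}
  zero_mem' := fun ε hε => ⟨1, one_pos, fun s t _ _ => by simpa using hε.le⟩
  add_mem' := by
    intro x y hx hy ε hε
    obtain ⟨d, hd, h1⟩ := hx (ε / 2) (by positivity)
    obtain ⟨d', hd', h2⟩ := hy (ε / 2) (by positivity)
    refine ⟨min d d', lt_min hd hd', fun s t hst hlt => ?_⟩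
    have a1 := h1 s t hst (hlt.trans_le (min_le_left _ _))
    have a2 := h2 s t hst (hlt.trans_le (min_le_right _ _))
    have hp := RClass.pos_sub ρ hst
    rw [div_le_iff₀ hp] at *
    have : (x + y) t - (x + y) s = (x t - x s) + (y t - y s) := by simp only [Pi.add_apply]; ring
    rw [this]
    linarith [abs_add_le (x t - x s) (y t - y s)]
  smul_mem' := by
    intro c x hx ε hε
    obtain ⟨d, hd, h1⟩ := hx (ε / (|c| + 1)) (by positivity)
    refine ⟨d, hd, fun s t hst hlt => ?_⟩
    have a1 := h1 s t hst hlt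
    have : (c • x) t - (c • x) s = c * (x t - x s) := by
      simp only [Pi.smul_apply, smul_eq_mul]; ring
    rw [this, abs_mul, mul_div_assoc]
    calc |c| * (|x t - x s| / ρ.1 (t - s)) ≤ |c| * (ε / (|c| + 1)) := by gcongr
      _ ≤ (|c| + 1) * (ε / (|c| + 1)) := by gcongr; linarith
      _ = ε := by field_simp

/-- The Hölder space `H_ρ^o`. (A separate type, so that it does not inherit the topology of pointwise
convergence.) -/
def LittleHolder {i : ℕ} (ρ : RClass i) : Type := littleHolderSubmodule ρ

namespace LittleHolder

variable {i : ℕ} {ρ : RClass i}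

instance : AddCommGroup (LittleHolder ρ) :=
  inferInstanceAs (AddCommGroup (littleHolderSubmodule ρ))

instance : Module ℝ (LittleHolder ρ) :=
  inferInstanceAs (Module ℝ (littleHolderSubmodule ρ))

instance : CoeFun (LittleHolder ρ) (fun _ => unitInterval → ℝ) := ⟨fun x => x.1⟩

/-- A function with the `o(ρ)` property, as an element of `H_ρ^o`. -/
def mk (x : unitInterval → ℝ) (hx : IsLittleHolder ρ.1 x) : LittleHolder ρ := Subtype.mk x hx

@[simp] lemma mk_apply (x : unitInterval → ℝ) (hx : IsLittleHolder ρ.1 x) (t : unitInterval) :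
    mk x hx t = x t := rfl
@[simp] lemma zero_apply (t : unitInterval) : (0 : LittleHolder ρ) t = 0 := rfl
@[simp] lemma add_apply (x y : LittleHolder ρ) (t : unitInterval) : (x + y) t = x t + y t := rfl
@[simp] lemma neg_apply (x : LittleHolder ρ) (t : unitInterval) : (-x) t = -x t := rfl
@[simp] lemma smul_apply (c : ℝ) (x : LittleHolder ρ) (t : unitInterval) :
    (c • x) t = c * x t := rfl

lemma ext {x y : LittleHolder ρ} (h : ∀ t, x t = y t) : x = y := Subtype.ext (funext h)

/-- The Hölder quotients of `x`, indexed by the pairs `s < t`. -/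
noncomputable def quot (x : LittleHolder ρ)
    (p : {p : unitInterval × unitInterval // p.1 < p.2}) : ℝ :=
  |x p.1.2 - x p.1.1| / ρ.1 ((p.1.2 : ℝ) - p.1.1)

lemma quot_nonneg (x : LittleHolder ρ) (p) : 0 ≤ quot x p :=
  div_nonneg (abs_nonneg _) (RClass.pos_sub ρ p.2).le

/-- The Hölder quotients of an element of `H_ρ^o` are bounded. -/
lemma bddAbove_quot (x : LittleHolder ρ) : BddAbove (Set.range (quot x)) := by
  obtain ⟨δ, hδ, h⟩ := x.2 1 one_pos
  obtain ⟨N, hN⟩ := exists_nat_one_div_lt hδ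
  refine ⟨N + 1, ?_⟩
  rintro _ ⟨⟨⟨s, t⟩, hst⟩, rfl⟩
  have hst' : (s : ℝ) < t := hst
  have hs := s.2.1
  have ht := t.2.2
  have hN0 : (0 : ℝ) < N + 1 := by positivity
  set d : ℝ := ((t : ℝ) - s) / (N + 1) with hd
  have hd0 : 0 < d := div_pos (by linarith) hN0
  have hNd : (N + 1) * d = t - s := by rw [hd]; field_simp
  have hd1 : d < δ := by
    refine lt_of_le_of_lt ?_ hN
    rw [hd]; gcongr; linarith
  have hdle : d ≤ t - s := by
    rw [hd]; exact div_le_self (by linarith) (by linarith [(Nat.cast_nonneg N : (0 : ℝ) ≤ N)])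
  let p : ℕ → unitInterval := fun k => Set.projIcc 0 1 zero_le_one (s + k * d)
  have hp : ∀ k : ℕ, k ≤ N + 1 → ((p k : unitInterval) : ℝ) = s + k * d := by
    intro k hk
    have hk' : (k : ℝ) ≤ N + 1 := by exact_mod_cast hk
    have : (k : ℝ) * d ≤ (N + 1) * d := by gcongr
    exact congrArg Subtype.val (Set.projIcc_of_mem zero_le_one
      ⟨by positivity, by linarith⟩)
  have hstep : ∀ k : ℕ, k < N + 1 → |x (p (k + 1)) - x (p k)| ≤ ρ.1 ((t : ℝ) - s) := by
    intro k hk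
    have e1 := hp (k + 1) hk
    have e0 := hp k hk.le
    have e : ((p (k + 1) : unitInterval) : ℝ) - p k = d := by
      rw [e1, e0]; push_cast; ring
    have hlt : p k < p (k + 1) := by
      have : ((p k : unitInterval) : ℝ) < p (k + 1) := by linarith
      exact this
    have := h (p k) (p (k + 1)) hlt (by rw [e]; exact hd1)
    rw [div_le_iff₀ (RClass.pos_sub ρ hlt), e, one_mul] at this
    exact this.trans (ρ.2.2.1 ⟨hd0.le, by linarith⟩ ⟨by linarith, by linarith⟩ hdle)
  have hsum : x t - x s = ∑ k ∈ Finset.range (N + 1), (x (p (k + 1)) - x (p k)) := by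
    rw [Finset.sum_range_sub (fun k => x (p k))]
    have h1 : p (N + 1) = t := Subtype.ext (by rw [hp _ le_rfl]; push_cast; linarith)
    have h0 : p 0 = s := Subtype.ext (by rw [hp _ (by omega)]; simp)
    rw [h1, h0]
  show |x t - x s| / ρ.1 ((t : ℝ) - s) ≤ N + 1
  rw [div_le_iff₀ (RClass.pos_sub ρ hst), hsum]
  refine (Finset.abs_sum_le_sum_abs _ _).trans ?_
  refine (Finset.sum_le_sum fun k hk => hstep k (Finset.mem_range.1 hk)).trans ?_
  simp

/-- `‖x‖_ρ = sup_{0 ≤ s < t ≤ 1} |x t - x s| / ρ (t - s) + |x 0|`. -/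
noncomputable def holderNorm (ρ : RClass i) : AddGroupNorm (LittleHolder ρ) where
  toFun x := (⨆ p, quot x p) + |x 0|
  map_zero' := by simp [quot]
  add_le' x y := by
    have : (⨆ p, quot (x + y) p) ≤ (⨆ p, quot x p) + ⨆ p, quot y p := by
      refine Real.iSup_le (fun p => ?_)
        (add_nonneg (Real.iSup_nonneg (quot_nonneg x)) (Real.iSup_nonneg (quot_nonneg y)))
      refine le_trans ?_ (add_le_add (le_ciSup (bddAbove_quot x) p) (le_ciSup (bddAbove_quot y) p))
      simp only [quot]
      rw [← add_div]
      refine div_le_div_of_nonneg_right ?_ (RClass.pos_sub ρ p.2).le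
      have e : (x + y) p.1.2 - (x + y) p.1.1
        = (x p.1.2 - x p.1.1) + (y p.1.2 - y p.1.1) := by simp only [add_apply]; ring
      rw [e]
      exact abs_add_le _ _
    have h0 := abs_add_le (x 0) (y 0)
    rw [add_apply]
    linarith
  neg' x := by
    have : ∀ p, quot (-x) p = quot x p := fun p => by
      simp only [quot, neg_apply]
      rw [← abs_neg]
      congr 2
      ring
    simp only [this, neg_apply, abs_neg]
  eq_zero_of_map_eq_zero' x hx := by
    have h1 : 0 ≤ ⨆ p, quot x p := Real.iSup_nonneg (quot_nonneg x)
    have h2 := abs_nonneg (x 0)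
    have hx' : (⨆ p, quot x p) + |x 0| = 0 := hx
    have h3 : x 0 = 0 := abs_eq_zero.1 (by linarith)
    refine ext fun t => ?_
    rcases eq_or_lt_of_le (show (0 : unitInterval) ≤ t from t.2.1) with h | h
    · rw [← h]; simpa using h3
    · have h4 := le_ciSup (bddAbove_quot x) ⟨(0, t), h⟩
      have h5 : quot x ⟨(0, t), h⟩ = 0 := le_antisymm (by linarith) (quot_nonneg _ _)
      rcases div_eq_zero_iff.1 h5 with h6 | h6
      · have := abs_eq_zero.1 h6
        simp only [h3, sub_zero] at this
        simpa using this
      · exact absurd h6 (RClass.pos_sub ρ h).ne'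

noncomputable instance : NormedAddCommGroup (LittleHolder ρ) :=
  (holderNorm ρ).toNormedAddCommGroup

lemma norm_def (x : LittleHolder ρ) : ‖x‖ = (⨆ p, quot x p) + |x 0| := rfl

instance : NormedSpace ℝ (LittleHolder ρ) where
  norm_smul_le c x := by
    have : ∀ p, quot (c • x) p = |c| * quot x p := fun p => by
      simp only [quot, smul_apply]
      rw [← mul_sub, abs_mul, mul_div_assoc]
    rw [norm_def, norm_def, Real.norm_eq_abs, mul_add]
    simp only [this, smul_apply, abs_mul]
    rw [Real.mul_iSup_of_nonneg (abs_nonneg c)]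

noncomputable instance : MeasurableSpace (LittleHolder ρ) := borel _

instance : BorelSpace (LittleHolder ρ) := ⟨rfl⟩

end LittleHolder

/-- `S_N = X_1 + ⋯ + X_N` (the sequence is indexed from `1`; `X 0` is not used). -/
def partialSum {Ω : Type*} (X : ℕ → Ω → ℝ) (N : ℕ) (ω : Ω) : ℝ :=
  ∑ j ∈ Finset.Icc 1 N, X j ω

/-- The polygonal partial-sum process
`W_n(t) = (1 / a_n) (∑_{j ≤ [nt]} X_j + (nt - [nt]) X_{[nt] + 1})`. -/
noncomputable def polygonalProcess {Ω : Type*} (X : ℕ → Ω → ℝ) (a : ℕ → ℝ) (n : ℕ) (ω : Ω)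
    (t : unitInterval) : ℝ :=
  1 / a n * (partialSum X ⌊(n : ℝ) * t⌋₊ ω
    + ((n : ℝ) * t - ⌊(n : ℝ) * t⌋₊) * X (⌊(n : ℝ) * t⌋₊ + 1) ω)

/-! Tightness reduces to a uniform modulus: the paths vanish at 0, and prescribing for each m a
scale below which increments are at most ρ/(m+1) cuts out a compact set
(`isCompact_iInter_modulusSet`). So for each ε one scale must serve all n with high probability.

The index n = 2^p is the convenient one, since the points n k 2^(-j), j ≤ p, are then integers and
the hypothesis bounds exactly the dyadic increments of the path down to its mesh. Below the mesh the
path is linear, so its increments halve at each level, while ρ loses at most a factor 2 because α ≤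
1/2; the bounds therefore persist at all levels (`dyadic_increment_le`). As α > 0, ρ(2^(-j)) decays
geometrically, and chaining turns dyadic bounds into a modulus (`RClass.exists_chaining_constant`).

A general n is compared with a power n ≤ 2^p ≤ 2n: W_n is W_(2^p) run on the time interval [0,
n/2^p] and multiplied by a(2^p)/a(n), which is bounded by the doubling condition
(`polygonalElement_mem_modulusSet`). The finitely many small n are handled one law at a time. -/

/-! ### The modulus ρ along dyadic scales -/

/-- The quotient is the exponential of the integral of η(u)/u over [x, 2x]. That interval has length
x and 1/u ≤ 1/x on it, so smallness of η alone makes the integral small. -/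
lemma NormalizedSlowlyVarying.tendsto_div {L : ℝ → ℝ} (hL : NormalizedSlowlyVarying L) :
    Tendsto (fun x => L (2 * x) / L x) atTop (𝓝 1) := by
  obtain ⟨b, c, η, hb, hc, hη, hint, hrep⟩ := hL
  have hint' : ∀ x, b ≤ x → IntervalIntegrable (fun u => η u / u) volume b x := by
    intro x hx
    simp only [div_eq_mul_inv]
    refine (hint x hx).mul_continuousOn (continuousOn_id.inv₀ fun u hu => ?_)
    rw [Set.uIcc_of_le hx] at hu
    exact (by linarith [hu.1] : (0 : ℝ) < u).ne'
  have hzero : Tendsto (fun x => ∫ u in x..(2 * x), η u / u) atTop (𝓝 0) := by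
    rw [Metric.tendsto_nhds]
    intro ε hε
    have h1 : ∀ᶠ u in atTop, ‖η u‖ < ε / 2 := by
      simpa using (Metric.tendsto_nhds.1 hη (ε / 2) (by positivity))
    obtain ⟨A, hA⟩ := eventually_atTop.1 h1
    filter_upwards [eventually_ge_atTop (max A 1)] with x hx
    have hxA : A ≤ x := (le_max_left _ _).trans hx
    have hx1 : 1 ≤ x := (le_max_right _ _).trans hx
    have hx0 : 0 < x := by linarith
    have key : ‖∫ u in x..(2 * x), η u / u‖ ≤ (ε / 2 / x) * |2 * x - x| := by
      refine intervalIntegral.norm_integral_le_of_norm_le_const fun u hu => ?_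
      rw [Set.uIoc_of_le (by linarith)] at hu
      have hu0 : 0 < u := by linarith [hu.1]
      rw [norm_div, Real.norm_of_nonneg hu0.le]
      have := (hA u (by linarith [hu.1])).le
      have hxu := hu.1.le
      gcongr
    have e : (ε / 2 / x) * |2 * x - x| = ε / 2 := by
      rw [show 2 * x - x = x by ring, abs_of_pos hx0]
      field_simp
    rw [dist_zero_right]
    linarith
  have hexp : Tendsto (fun x => Real.exp (∫ u in x..(2 * x), η u / u)) atTop (𝓝 1) := by
    have := (Real.continuous_exp.tendsto 0).comp hzero
    rwa [Real.exp_zero] at this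
  refine hexp.congr' ?_
  filter_upwards [eventually_ge_atTop b] with x hx
  have h2 : b ≤ 2 * x := by linarith
  rw [hrep x hx, hrep _ h2, mul_div_mul_left _ _ hc.ne', ← Real.exp_sub,
    intervalIntegral.integral_interval_sub_left (hint' _ h2) (hint' _ hx)]

namespace RClass

variable {i : ℕ} (ρ : RClass i)

lemma mono {s t : ℝ} (hs : 0 ≤ s) (hst : s ≤ t) (ht : t ≤ 1) : ρ.1 s ≤ ρ.1 t :=
  ρ.2.2.1 ⟨hs, hst.trans ht⟩ ⟨hs.trans hst, ht⟩ hst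

lemma dyadic_pos (m : ℕ) : 0 < ρ.1 ((2 ^ m)⁻¹) :=
  RClass.pos ρ (by positivity) (inv_le_one_of_one_le₀ (one_le_pow₀ (by norm_num)))

/-- The growth condition, without its logarithmic factor. -/
lemma tendsto_mul_rpow : Tendsto (fun δ : ℝ => ρ.1 δ * δ ^ (-(1 / 2) : ℝ)) (𝓝[>] 0) atTop := by
  refine tendsto_atTop_mono' _ ?_ ρ.2.2.2
  have hlog : ∀ᶠ δ : ℝ in 𝓝[>] 0, 1 ≤ Real.log δ⁻¹ :=
    (Real.tendsto_log_atTop.comp tendsto_inv_nhdsGT_zero).eventually_ge_atTop 1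
  filter_upwards [hlog, Ioc_mem_nhdsGT (zero_lt_one' ℝ)] with δ h1 h2
  have hp := RClass.pos ρ h2.1 h2.2
  have hr := Real.rpow_pos_of_pos h2.1 (-(1 / 2) : ℝ)
  refine mul_le_of_le_one_right (by positivity) (Real.rpow_le_one_of_one_le_of_nonpos h1 ?_)
  have : (0 : ℝ) ≤ i := Nat.cast_nonneg i
  linarith

lemma tendsto_dyadic_ratio : ∃ α : ℝ, 0 < α ∧
    Tendsto (fun m : ℕ => ρ.1 ((2 ^ (m + 1))⁻¹) / ρ.1 ((2 ^ m)⁻¹)) atTop (𝓝 (2 ^ (-α))) := by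
  obtain ⟨⟨α, L, hα, hL, hLpos, -, -, hρ⟩, -⟩ := ρ.2
  refine ⟨α, hα, ?_⟩
  have h1 := (hL.tendsto_div.comp (tendsto_pow_atTop_atTop_of_one_lt (one_lt_two (α := ℝ)))).const_mul
    ((2 : ℝ) ^ (-α))
  rw [mul_one] at h1
  refine h1.congr fun m => ?_
  have e : ∀ m : ℕ, ρ.1 ((2 ^ m)⁻¹) = ((2 ^ m : ℝ)⁻¹) ^ α * L (2 ^ m) := fun m => by
    rw [hρ _ (by positivity) (inv_le_one_of_one_le₀ (one_le_pow₀ (by norm_num))), one_div, inv_inv]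
  have hpow : ((2 ^ (m + 1) : ℝ)⁻¹) ^ α = 2 ^ (-α) * ((2 ^ m : ℝ)⁻¹) ^ α := by
    rw [pow_succ', mul_inv, Real.mul_rpow (by norm_num) (by positivity), Real.rpow_neg (by norm_num),
      Real.inv_rpow (by norm_num)]
  have h0 : ((2 ^ m : ℝ)⁻¹) ^ α ≠ 0 := (Real.rpow_pos_of_pos (by positivity) _).ne'
  have hL0 : L (2 ^ m) ≠ 0 := (hLpos _ (one_le_pow₀ (by norm_num))).ne'
  rw [e, e, hpow, Function.comp_apply, pow_succ']
  field_simp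

/-- If α exceeded 1/2, the ratios would eventually lie below 2^(-1/2), so ρ(2^(-m)) 2^(m/2) would
eventually be non-increasing, against its divergence. -/
lemma tendsto_dyadic_ratio_le_half : ∃ α : ℝ, 0 < α ∧ α ≤ 1 / 2 ∧
    Tendsto (fun m : ℕ => ρ.1 ((2 ^ (m + 1))⁻¹) / ρ.1 ((2 ^ m)⁻¹)) atTop (𝓝 (2 ^ (-α))) := by
  obtain ⟨α, hα, h⟩ := tendsto_dyadic_ratio ρ
  refine ⟨α, hα, ?_, h⟩
  by_contra! hlt
  have h1 : (2 : ℝ) ^ (-α) < 2 ^ (-(1 / 2) : ℝ) :=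
    Real.rpow_lt_rpow_of_exponent_lt one_lt_two (by linarith)
  obtain ⟨M, hM⟩ := eventually_atTop.1 (h.eventually_lt_const h1)
  have hdy : Tendsto (fun m : ℕ => ((2 : ℝ) ^ m)⁻¹) atTop (𝓝[>] 0) :=
    tendsto_inv_atTop_nhdsGT_zero.comp (tendsto_pow_atTop_atTop_of_one_lt one_lt_two)
  have hinf := (tendsto_mul_rpow ρ).comp hdy
  set g : ℕ → ℝ := (fun δ : ℝ => ρ.1 δ * δ ^ (-(1 / 2) : ℝ)) ∘ fun m : ℕ => ((2 : ℝ) ^ m)⁻¹ with hg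
  have hstep : ∀ m, M ≤ m → g (m + 1) ≤ g m := by
    intro m hm
    have h2 := (hM m hm).le
    rw [div_le_iff₀ (dyadic_pos ρ m)] at h2
    have hq : (0 : ℝ) < ((2 ^ m : ℝ)⁻¹) ^ (-(1 / 2) : ℝ) := Real.rpow_pos_of_pos (by positivity) _
    have e : ((2 ^ (m + 1) : ℝ)⁻¹) ^ (-(1 / 2) : ℝ)
        = (2 ^ (-(1 / 2) : ℝ))⁻¹ * ((2 ^ m : ℝ)⁻¹) ^ (-(1 / 2) : ℝ) := by
      rw [pow_succ', mul_inv, Real.mul_rpow (by norm_num) (by positivity), Real.inv_rpow (by norm_num)]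
    have hc : (0 : ℝ) < 2 ^ (-(1 / 2) : ℝ) := Real.rpow_pos_of_pos (by norm_num) _
    simp only [hg, Function.comp_apply]
    rw [e]
    calc _ ≤ (2 ^ (-(1 / 2) : ℝ) * ρ.1 ((2 ^ m)⁻¹)) *
          ((2 ^ (-(1 / 2) : ℝ))⁻¹ * ((2 ^ m : ℝ)⁻¹) ^ (-(1 / 2) : ℝ)) := by gcongr
      _ = _ := by field_simp
  have hb : ∀ m, M ≤ m → g m ≤ g M := fun m hm => by
    induction m, hm using Nat.le_induction with
    | base => exact le_rfl
    | succ m hm ih => exact (hstep m hm).trans ih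
  obtain ⟨m, hm1, hm2⟩ := ((hinf.eventually_gt_atTop (g M)).and (eventually_ge_atTop M)).exists
  exact absurd hm1 (hb m hm2).not_gt

/-- Along the dyadic scale, `ρ` decays geometrically, but more slowly than the identity. -/
lemma exists_dyadic_bounds : ∃ q : ℝ, 0 ≤ q ∧ q < 1 ∧ ∃ M : ℕ, ∀ m, M ≤ m →
    ρ.1 ((2 ^ (m + 1))⁻¹) ≤ q * ρ.1 ((2 ^ m)⁻¹) ∧
      ρ.1 ((2 ^ m)⁻¹) ≤ 2 * ρ.1 ((2 ^ (m + 1))⁻¹) := by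
  obtain ⟨α, h0, h1, h⟩ := tendsto_dyadic_ratio_le_half ρ
  have hlt : (2 : ℝ) ^ (-α) < 1 := Real.rpow_lt_one_of_one_lt_of_neg one_lt_two (by linarith)
  -- Only α < 1 matters here: it keeps the limiting ratio strictly above the factor 1/2 by which
  -- linear increments shrink.
  have hgt : (1 / 2 : ℝ) < 2 ^ (-α) := by
    have := Real.rpow_lt_rpow_of_exponent_lt one_lt_two (show (-1 : ℝ) < -α by linarith)
    rwa [Real.rpow_neg_one, ← one_div] at this
  obtain ⟨q, hq1, hq2⟩ := exists_between hlt
  obtain ⟨M, hM⟩ := eventually_atTop.1 ((h.eventually_lt_const hq1).and (h.eventually_const_lt hgt))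
  refine ⟨q, by linarith, hq2, M, fun m hm => ?_⟩
  obtain ⟨h2, h3⟩ := hM m hm
  have hp := dyadic_pos ρ m
  rw [div_lt_iff₀ hp] at h2
  rw [lt_div_iff₀ hp] at h3
  exact ⟨h2.le, by linarith⟩

end RClass

/-- Since δ^(-1/2) ≤ δ^(-1) on (0, 1], the growth condition gives ρ(δ)/δ → ∞. This places polygonal
paths in the space. -/
lemma isLittleHolder_of_lipschitz {i : ℕ} (ρ : RClass i) {x : unitInterval → ℝ} {C : ℝ}
    (hx : ∀ s t : unitInterval, s < t → |x t - x s| ≤ C * (t - s)) : IsLittleHolder ρ.1 x := by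
  intro ε hε
  have hev := (RClass.tendsto_mul_rpow ρ).eventually_ge_atTop (|C| / ε)
  obtain ⟨δ, hδ, h⟩ := mem_nhdsGT_iff_exists_Ioo_subset.1 hev
  have hδ' : (0 : ℝ) < δ := hδ
  refine ⟨δ, hδ', fun s t hst hlt => ?_⟩
  have hst' : (s : ℝ) < t := hst
  have hd0 : 0 < (t : ℝ) - s := by linarith
  have hd1 : (t : ℝ) - s ≤ 1 := by linarith [t.2.2, s.2.1]
  have h1 : |C| / ε ≤ ρ.1 (t - s) * ((t : ℝ) - s) ^ (-(1 / 2) : ℝ) := h ⟨hd0, hlt⟩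
  have h2 : ((t : ℝ) - s) ^ (-(1 / 2) : ℝ) ≤ ((t : ℝ) - s)⁻¹ := by
    rw [← Real.rpow_neg_one]
    exact Real.rpow_le_rpow_of_exponent_ge hd0 hd1 (by norm_num)
  have hp := RClass.pos_sub ρ hst
  have h3 : |C| / ε ≤ ρ.1 (t - s) * ((t : ℝ) - s)⁻¹ := h1.trans (by gcongr)
  rw [div_le_iff₀ hε, ← div_eq_mul_inv, div_mul_eq_mul_div, le_div_iff₀ hd0] at h3
  rw [div_le_iff₀ hp]
  have h4 := hx s t hst
  have h5 := mul_le_mul_of_nonneg_right (le_abs_self C) hd0.le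
  linarith

/-! ### Piecewise linear paths -/

/-- The piecewise linear interpolation of the partial sums of a sequence indexed from `1`. -/
noncomputable def interpolatedSum (x : ℕ → ℝ) (y : ℝ) : ℝ :=
  ∑ j ∈ Finset.Icc 1 ⌊y⌋₊, x j + (y - ⌊y⌋₊) * x (⌊y⌋₊ + 1)

namespace interpolatedSum

variable (x : ℕ → ℝ)

/-- At y = m + 1 the floor jumps but the two formulas agree, so a whole closed cell can be treated
at once. -/
lemma eq_of_mem {m : ℕ} {y : ℝ} (h1 : m ≤ y) (h2 : y ≤ m + 1) :
    interpolatedSum x y = ∑ j ∈ Finset.Icc 1 m, x j + (y - m) * x (m + 1) := by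
  rcases h2.eq_or_lt with h | h
  · have e : ⌊y⌋₊ = m + 1 := by rw [h]; exact_mod_cast Nat.floor_natCast (R := ℝ) (m + 1)
    rw [interpolatedSum, e, Finset.sum_Icc_succ_top (by omega), h]
    push_cast
    ring
  · have e : ⌊y⌋₊ = m := (Nat.floor_eq_iff (m.cast_nonneg.trans h1)).2 ⟨h1, h⟩
    rw [interpolatedSum, e]

lemma natCast (m : ℕ) : interpolatedSum x m = ∑ j ∈ Finset.Icc 1 m, x j := by
  simp [interpolatedSum]

lemma sub_of_mem {m : ℕ} {u v : ℝ} (hu : (m : ℝ) ≤ u) (huv : u ≤ v) (hv : v ≤ m + 1) :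
    interpolatedSum x v - interpolatedSum x u
      = (v - u) * (interpolatedSum x ((m + 1 : ℕ) : ℝ) - interpolatedSum x (m : ℝ)) := by
  rw [eq_of_mem x (hu.trans huv) hv, eq_of_mem x hu (huv.trans hv), natCast, natCast,
    Finset.sum_Icc_succ_top (by omega)]
  ring

/-- The piecewise linear path as a combination of ramps. -/
lemma eq_sum_ramp (n : ℕ) {y : ℝ} (h0 : 0 ≤ y) (hn : y ≤ n) :
    interpolatedSum x y = ∑ j ∈ Finset.range n, x (j + 1) * max 0 (min 1 (y - j)) := by
  induction n with
  | zero =>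
    have : y = 0 := le_antisymm (by simpa using hn) h0
    simp [interpolatedSum, this]
  | succ n ih =>
    rw [Finset.sum_range_succ]
    push_cast at hn
    rcases le_or_gt y n with h | h
    · rw [ih h, max_eq_left ((min_le_right _ _).trans (by linarith))]
      simp
    · have hj : ∀ j ∈ Finset.range n, x (j + 1) * max 0 (min 1 (y - j)) = x (j + 1) := by
        intro j hj
        have : (j : ℝ) + 1 ≤ n := by exact_mod_cast Finset.mem_range.1 hj
        rw [min_eq_left (by linarith), max_eq_right zero_le_one, mul_one]
      rw [Finset.sum_congr rfl hj, min_eq_right (by linarith), max_eq_right (by linarith),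
        eq_of_mem x h.le hn, Finset.range_eq_Ico,
        Finset.sum_Ico_add' (fun j => x j) 0 n 1, mul_comm]
      rfl

lemma abs_ramp_sub_le (c u v : ℝ) :
    |max 0 (min 1 (v - c)) - max 0 (min 1 (u - c))| ≤ |v - u| := by
  refine (abs_max_sub_max_le_max 0 _ 0 _).trans (max_le (by simp) ?_)
  refine (abs_min_sub_min_le_max 1 _ 1 _).trans (max_le (by simp) ?_)
  rw [sub_sub_sub_cancel_right]

lemma continuousOn (n : ℕ) : ContinuousOn (interpolatedSum x) (Set.Icc 0 n) := by
  have h : Continuous fun y : ℝ => ∑ j ∈ Finset.range n, x (j + 1) * max 0 (min 1 (y - j)) := by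
    fun_prop
  exact h.continuousOn.congr fun y hy => eq_sum_ramp x n hy.1 hy.2

/-- Bounds on the dyadic increments down to the mesh of the path propagate to all finer levels. -/
lemma dyadic_increment_le {p J : ℕ} (hJ : J ≤ p) {ω : ℕ → ℝ}
    (hω : ∀ j, J ≤ j → ω j ≤ 2 * ω (j + 1))
    (h : ∀ j, J ≤ j → j ≤ p → ∀ k < 2 ^ j,
      |interpolatedSum x (2 ^ p * (((k + 1 : ℕ) : ℝ) / 2 ^ j))
        - interpolatedSum x (2 ^ p * ((k : ℝ) / 2 ^ j))| ≤ ω j)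
    (j : ℕ) (hj : J ≤ j) (k : ℕ) (hk : k < 2 ^ j) :
    |interpolatedSum x (2 ^ p * (((k + 1 : ℕ) : ℝ) / 2 ^ j))
      - interpolatedSum x (2 ^ p * ((k : ℝ) / 2 ^ j))| ≤ ω j := by
  rcases le_or_gt j p with hjp | hjp
  · exact h j hj hjp k hk
  obtain ⟨l, rfl⟩ := Nat.exists_eq_add_of_le hjp.le
  have hωl : ω p ≤ 2 ^ l * ω (p + l) := by
    clear hk hj hjp
    induction l with
    | zero => simp
    | succ l ih =>
      have := mul_le_mul_of_nonneg_left (hω (p + l) (by omega)) (by positivity : (0 : ℝ) ≤ 2 ^ l)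
      rw [pow_succ, mul_assoc]
      exact ih.trans this
  have e : ∀ r : ℝ, (2 : ℝ) ^ p * (r / 2 ^ (p + l)) = r / 2 ^ l := fun r => by
    rw [pow_add]; field_simp
  -- This is the mesh cell containing the k-th dyadic interval of level p + l; there the increment
  -- is 2^(-l) times that of the cell.
  set m := k / 2 ^ l with hm
  have hl : (0 : ℝ) < 2 ^ l := by positivity
  have h1 : m * 2 ^ l ≤ k := Nat.div_mul_le_self _ _
  have h2 : k + 1 ≤ (m + 1) * 2 ^ l := Nat.lt_mul_of_div_lt (Nat.lt_succ_self _) (by positivity)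
  have h1' : (m : ℝ) * 2 ^ l ≤ k := by exact_mod_cast h1
  have h2' : (k : ℝ) + 1 ≤ (m + 1) * 2 ^ l := by exact_mod_cast h2
  have hmp : m < 2 ^ p := by
    rw [hm, Nat.div_lt_iff_lt_mul (by positivity), ← pow_add]; exact hk
  have hlev := h p hJ le_rfl m hmp
  rw [mul_div_cancel₀ _ (by positivity), mul_div_cancel₀ _ (by positivity)] at hlev
  rw [e, e, sub_of_mem x (m := m) (by rwa [le_div_iff₀ hl])
    (by gcongr; simp) (by rw [div_le_iff₀ hl]; push_cast; exact h2'), abs_mul]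
  have e2 : |((k + 1 : ℕ) : ℝ) / 2 ^ l - k / 2 ^ l| = (2 ^ l)⁻¹ := by
    rw [← sub_div]
    push_cast
    rw [add_sub_cancel_left, one_div, abs_of_pos (by positivity)]
  rw [e2, inv_mul_le_iff₀ hl]
  exact hlev.trans hωl

end interpolatedSum

/-! ### Chaining over dyadic points -/

section Chaining

variable {f : ℝ → ℝ} {J : ℕ} {ω : ℕ → ℝ} {q : ℝ}

/-- Passing to the next level sends the floor k to 2k or 2k + 1, so successive dyadic approximations
from below coincide or are neighbours. -/
lemma abs_floor_succ_sub_floor_le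
    (hω0 : ∀ j, 0 ≤ ω j)
    (h : ∀ j, J ≤ j → ∀ k < 2 ^ j,
      |f (((k + 1 : ℕ) : ℝ) / 2 ^ j) - f ((k : ℝ) / 2 ^ j)| ≤ ω j)
    {t : ℝ} (h0 : 0 ≤ t) (h1 : t ≤ 1) {j : ℕ} (hj : J ≤ j + 1) :
    |f ((⌊2 ^ (j + 1) * t⌋₊ : ℝ) / 2 ^ (j + 1)) - f ((⌊2 ^ j * t⌋₊ : ℝ) / 2 ^ j)|
      ≤ ω (j + 1) := by
  set k := ⌊2 ^ j * t⌋₊ with hk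
  have hk1 : (k : ℝ) ≤ 2 ^ j * t := Nat.floor_le (by positivity)
  have hk2 : 2 ^ j * t < k + 1 := Nat.lt_floor_add_one _
  have e0 : (k : ℝ) / 2 ^ j = ((2 * k : ℕ) : ℝ) / 2 ^ (j + 1) := by
    rw [pow_succ']; push_cast; field_simp
  have h2k : 2 * k ≤ ⌊2 ^ (j + 1) * t⌋₊ := Nat.le_floor (by rw [pow_succ']; push_cast; linarith)
  have h2k' : ⌊2 ^ (j + 1) * t⌋₊ < 2 * k + 2 := by
    rw [Nat.floor_lt (by positivity), pow_succ']; push_cast; linarith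
  rw [e0]
  obtain e | e : ⌊2 ^ (j + 1) * t⌋₊ = 2 * k ∨ ⌊2 ^ (j + 1) * t⌋₊ = 2 * k + 1 := by omega
  · rw [e, sub_self, abs_zero]; exact hω0 _
  · rw [e]
    refine h (j + 1) hj (2 * k) ?_
    have h3 : ((2 * k + 1 : ℕ) : ℝ) ≤ 2 ^ (j + 1) * t := by
      rw [← e]; exact Nat.floor_le (by positivity)
    have h4 : (2 : ℝ) ^ (j + 1) * t ≤ 2 ^ (j + 1) := mul_le_of_le_one_right (by positivity) h1
    exact_mod_cast h3.trans h4

/-- Telescoping along the dyadic approximations of t gives a geometric series with sum q/(1 - q)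
times ω j; continuity passes the bound to t. -/
lemma abs_sub_floor_le (hf : ContinuousOn f (Set.Icc 0 1)) (hω0 : ∀ j, 0 ≤ ω j)
    (hq1 : q < 1) (hωq : ∀ j, J ≤ j → ω (j + 1) ≤ q * ω j)
    (h : ∀ j, J ≤ j → ∀ k < 2 ^ j,
      |f (((k + 1 : ℕ) : ℝ) / 2 ^ j) - f ((k : ℝ) / 2 ^ j)| ≤ ω j)
    {t : ℝ} (h0 : 0 ≤ t) (h1 : t ≤ 1) {j : ℕ} (hj : J ≤ j) :
    |f t - f ((⌊2 ^ j * t⌋₊ : ℝ) / 2 ^ j)| ≤ q / (1 - q) * ω j := by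
  have hq' : 0 < 1 - q := by linarith
  have hfin : ∀ m j, J ≤ j → |f ((⌊2 ^ (j + m) * t⌋₊ : ℝ) / 2 ^ (j + m))
      - f ((⌊2 ^ j * t⌋₊ : ℝ) / 2 ^ j)| ≤ q / (1 - q) * ω j := by
    intro m
    induction m with
    | zero =>
      intro j hj
      -- No sign of q is assumed; nonnegativity of q * ω j comes from that of ω (j + 1).
      have := (hω0 (j + 1)).trans (hωq j hj)
      simp only [add_zero, sub_self, abs_zero]
      rw [div_mul_eq_mul_div]
      positivity
    | succ m ih =>
      intro j hj
      have h2 := ih (j + 1) (by omega)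
      have h3 := abs_floor_succ_sub_floor_le hω0 h h0 h1 (j := j) (by omega)
      rw [show j + 1 + m = j + (m + 1) by ring] at h2
      refine (abs_sub_le _ _ _).trans ((add_le_add h2 h3).trans ?_)
      have h4 : q / (1 - q) * ω (j + 1) + ω (j + 1) = ω (j + 1) / (1 - q) := by
        field_simp; ring
      rw [h4, div_mul_eq_mul_div]
      exact div_le_div_of_nonneg_right (hωq j hj) hq'.le
  have hpow : Tendsto (fun m : ℕ => (2 : ℝ) ^ (j + m)) atTop atTop :=
    (tendsto_pow_atTop_atTop_of_one_lt one_lt_two).comp (tendsto_add_atTop_iff_nat j |>.2 tendsto_id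
      |>.congr fun m => add_comm _ _)
  have hlim : Tendsto (fun m : ℕ => (⌊2 ^ (j + m) * t⌋₊ : ℝ) / 2 ^ (j + m)) atTop
      (𝓝[Set.Icc 0 1] t) := by
    refine tendsto_nhdsWithin_iff.2 ⟨?_, Eventually.of_forall fun m => ⟨by positivity, ?_⟩⟩
    · have := (tendsto_nat_floor_mul_div_atTop h0).comp hpow
      refine this.congr fun m => ?_
      simp [mul_comm]
    · refine div_le_one_of_le₀ ?_ (by positivity)
      exact (Nat.floor_le (by positivity)).trans (mul_le_of_le_one_right (by positivity) h1)
  have hlim2 := ((((hf t ⟨h0, h1⟩).tendsto.comp hlim).sub_const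
    (f ((⌊2 ^ j * t⌋₊ : ℝ) / 2 ^ j))).abs)
  exact le_of_tendsto hlim2 (Eventually.of_forall fun m => hfin m j hj)

/-- Chaining: geometrically decaying bounds on dyadic increments control all increments. -/
lemma abs_sub_le_of_dyadic (hf : ContinuousOn f (Set.Icc 0 1)) (hω0 : ∀ j, 0 ≤ ω j)
    (hq1 : q < 1) (hωq : ∀ j, J ≤ j → ω (j + 1) ≤ q * ω j)
    (h : ∀ j, J ≤ j → ∀ k < 2 ^ j,
      |f (((k + 1 : ℕ) : ℝ) / 2 ^ j) - f ((k : ℝ) / 2 ^ j)| ≤ ω j)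
    {s t : ℝ} (h0 : 0 ≤ s) (hst : s ≤ t) (h1 : t ≤ 1) {j : ℕ} (hj : J ≤ j)
    (hts : t - s ≤ (2 ^ j)⁻¹) :
    |f t - f s| ≤ (2 * (q / (1 - q)) + 1) * ω j := by
  have ht := abs_sub_floor_le hf hω0 hq1 hωq h (h0.trans hst) h1 hj
  have hs := abs_sub_floor_le hf hω0 hq1 hωq h h0 (hst.trans h1) hj
  have hmid : |f ((⌊2 ^ j * t⌋₊ : ℝ) / 2 ^ j) - f ((⌊2 ^ j * s⌋₊ : ℝ) / 2 ^ j)| ≤ ω j := by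
    have h2j : (0 : ℝ) < 2 ^ j := by positivity
    have h2 : ⌊2 ^ j * s⌋₊ ≤ ⌊2 ^ j * t⌋₊ := Nat.floor_mono (by gcongr)
    have h3 : ⌊2 ^ j * t⌋₊ ≤ ⌊2 ^ j * s⌋₊ + 1 := by
      rw [← Nat.floor_add_one (by positivity)]
      refine Nat.floor_mono ?_
      have := mul_le_mul_of_nonneg_left hts h2j.le
      rw [mul_inv_cancel₀ h2j.ne'] at this
      linarith
    obtain e | e : ⌊2 ^ j * t⌋₊ = ⌊2 ^ j * s⌋₊ ∨ ⌊2 ^ j * t⌋₊ = ⌊2 ^ j * s⌋₊ + 1 := by omega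
    · rw [e, sub_self, abs_zero]; exact hω0 _
    · rw [e]
      refine h j hj _ ?_
      have h4 : ((⌊2 ^ j * s⌋₊ + 1 : ℕ) : ℝ) ≤ 2 ^ j * t := by
        rw [← e]; exact Nat.floor_le (mul_nonneg h2j.le (h0.trans hst))
      have h5 : (2 : ℝ) ^ j * t ≤ 2 ^ j := mul_le_of_le_one_right h2j.le h1
      exact_mod_cast h4.trans h5
  rw [abs_le] at *
  constructor <;> linarith [ht.1, ht.2, hs.1, hs.2, hmid.1, hmid.2]

end Chaining

/-- If the dyadic increments of a rescaled partial-sum path are bounded by `D * ρ` down to its mesh,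
the path has modulus of continuity a constant multiple of `D * ρ`. -/
lemma RClass.exists_chaining_constant {i : ℕ} (ρ : RClass i) : ∃ C : ℝ, 0 < C ∧ ∃ M : ℕ,
    ∀ (x : ℕ → ℝ) (D : ℝ) (J p : ℕ), 0 ≤ D → M ≤ J → J ≤ p →
    (∀ j, J ≤ j → j ≤ p → ∀ k < 2 ^ j,
      |interpolatedSum x (2 ^ p * (((k + 1 : ℕ) : ℝ) / 2 ^ j))
        - interpolatedSum x (2 ^ p * ((k : ℝ) / 2 ^ j))| ≤ D * ρ.1 ((2 ^ j)⁻¹)) →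
    ∀ s t : ℝ, 0 ≤ s → s < t → t ≤ 1 → t - s < (2 ^ J)⁻¹ →
      |interpolatedSum x (2 ^ p * t) - interpolatedSum x (2 ^ p * s)| ≤ C * D * ρ.1 (t - s) := by
  obtain ⟨q, hq0, hq1, M, hM⟩ := RClass.exists_dyadic_bounds ρ
  have hq' : 0 < 1 - q := by linarith
  -- The outer factor 2 pays for replacing ρ(2^(-j)) by ρ(2^(-(j+1))), which is at most ρ(t - s).
  refine ⟨2 * (2 * (q / (1 - q)) + 1), by positivity, M, ?_⟩
  intro x D J p hD hMJ hJp h s t hs hst ht hts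
  have hω2 : ∀ j, J ≤ j → D * ρ.1 ((2 ^ j)⁻¹) ≤ 2 * (D * ρ.1 ((2 ^ (j + 1))⁻¹)) := by
    intro j hj
    have := mul_le_mul_of_nonneg_left (hM j (hMJ.trans hj)).2 hD
    linarith
  have hωq : ∀ j, J ≤ j → D * ρ.1 ((2 ^ (j + 1))⁻¹) ≤ q * (D * ρ.1 ((2 ^ j)⁻¹)) := by
    intro j hj
    have := mul_le_mul_of_nonneg_left (hM j (hMJ.trans hj)).1 hD
    linarith
  have hall := interpolatedSum.dyadic_increment_le x hJp hω2 h
  have hcont : ContinuousOn (fun u => interpolatedSum x (2 ^ p * u)) (Set.Icc 0 1) := by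
    refine (interpolatedSum.continuousOn x (2 ^ p)).comp (by fun_prop) fun u hu => ?_
    have : (0 : ℝ) < 2 ^ p := by positivity
    exact ⟨mul_nonneg this.le hu.1, by push_cast; exact mul_le_of_le_one_right this.le hu.2⟩
  -- The scale j satisfies 2^(-(j+1)) < t - s ≤ 2^(-j).
  obtain ⟨j, hj1, hj2⟩ := exists_nat_pow_near_of_lt_one (x := t - s) (y := (2 : ℝ)⁻¹)
    (by linarith) (by linarith) (by norm_num) (by norm_num)
  rw [inv_pow] at hj1 hj2
  have hJj : J ≤ j := by
    have h2 : ((2 : ℝ) ^ (j + 1))⁻¹ < (2 ^ J)⁻¹ := hj1.trans hts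
    rw [inv_lt_inv₀ (by positivity) (by positivity), pow_lt_pow_iff_right₀ one_lt_two] at h2
    omega
  have key := abs_sub_le_of_dyadic (ω := fun j => D * ρ.1 ((2 ^ j)⁻¹)) hcont
    (fun j => mul_nonneg hD (RClass.dyadic_pos ρ j).le) hq1 hωq hall hs hst.le ht hJj hj2
  refine key.trans ?_
  have h3 : D * ρ.1 ((2 ^ (j + 1))⁻¹) ≤ D * ρ.1 (t - s) :=
    mul_le_mul_of_nonneg_left (RClass.mono ρ (by positivity) hj1.le (by linarith)) hD
  have h4 := (hω2 j hJj).trans (mul_le_mul_of_nonneg_left h3 zero_le_two)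
  have h5 := mul_le_mul_of_nonneg_left h4 (by positivity : 0 ≤ 2 * (q / (1 - q)) + 1)
  linarith

/-! ### Evaluations and modulus sets in the Hölder space -/

namespace LittleHolder

variable {i : ℕ} {ρ : RClass i}

lemma sub_apply (x y : LittleHolder ρ) (t : unitInterval) : (x - y) t = x t - y t := by
  rw [sub_eq_add_neg, add_apply, neg_apply, sub_eq_add_neg]

lemma norm_le {x : LittleHolder ρ} {A : ℝ} (hA : 0 ≤ A) (h0 : x 0 = 0)
    (h : ∀ s t : unitInterval, s < t → |x t - x s| ≤ A * ρ.1 (t - s)) : ‖x‖ ≤ A := by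
  rw [norm_def, h0, abs_zero, add_zero]
  exact Real.iSup_le (fun p => (div_le_iff₀ (RClass.pos_sub ρ p.2)).2 (h _ _ p.2)) hA

lemma abs_sub_le_norm (x : LittleHolder ρ) {s t : unitInterval} (h : s < t) :
    |x t - x s| ≤ ‖x‖ * ρ.1 (t - s) := by
  rw [← div_le_iff₀ (RClass.pos_sub ρ h), norm_def]
  exact (le_ciSup (bddAbove_quot x) ⟨(s, t), h⟩).trans (le_add_of_nonneg_right (abs_nonneg _))

lemma abs_apply_zero_le_norm (x : LittleHolder ρ) : |x 0| ≤ ‖x‖ :=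
  le_add_of_nonneg_left (Real.iSup_nonneg (quot_nonneg x))

/-- Evaluation is linear and bounded, as |x t| ≤ |x 0| + ‖x‖ ρ(1). It makes the modulus sets closed,
hence Borel. -/
lemma continuous_apply (t : unitInterval) : Continuous fun x : LittleHolder ρ => x t := by
  let e : LittleHolder ρ →ₗ[ℝ] ℝ :=
    { toFun := fun x => x t, map_add' := fun x y => rfl, map_smul' := fun c x => rfl }
  refine (e.mkContinuous (1 + ρ.1 1) fun x => ?_).continuous
  have hρ1 : 0 < ρ.1 1 := RClass.pos ρ one_pos le_rfl
  have h0 := abs_apply_zero_le_norm x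
  have hx := norm_nonneg x
  show |x t| ≤ (1 + ρ.1 1) * ‖x‖
  rcases eq_or_lt_of_le (show (0 : unitInterval) ≤ t from t.2.1) with h | h
  · rw [← h]
    nlinarith
  · have h1 := abs_sub_le_norm x h
    have h2 : ρ.1 ((t : ℝ) - (0 : unitInterval)) ≤ ρ.1 1 := by
      have h3 : (0 : ℝ) ≤ t := t.2.1
      have h4 : (t : ℝ) ≤ 1 := t.2.2
      refine RClass.mono ρ ?_ ?_ le_rfl <;> simpa
    have h3 := mul_le_mul_of_nonneg_left h2 hx
    have h4 := abs_sub_abs_le_abs_sub (x t) (x 0)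
    linarith

/-- The functions whose increments over distances less than `δ` are at most `ε * ρ`. -/
def modulusSet (ρ : RClass i) (ε δ : ℝ) : Set (LittleHolder ρ) :=
  {x | ∀ s t : unitInterval, s < t → (t : ℝ) - s < δ → |x t - x s| ≤ ε * ρ.1 (t - s)}

lemma isClosed_modulusSet (ε δ : ℝ) : IsClosed (modulusSet ρ ε δ) := by
  simp only [modulusSet, Set.ofPred_forall]
  refine isClosed_iInter fun s => isClosed_iInter fun t => isClosed_iInter fun _ =>
    isClosed_iInter fun _ => isClosed_le ?_ continuous_const
  exact ((continuous_apply t).sub (continuous_apply s)).abs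

lemma modulusSet_anti (ε : ℝ) {δ δ' : ℝ} (h : δ ≤ δ') :
    modulusSet ρ ε δ' ⊆ modulusSet ρ ε δ :=
  fun _ hx s t hst hd => hx s t hst (hd.trans_le h)

lemma exists_mem_modulusSet (x : LittleHolder ρ) {ε : ℝ} (hε : 0 < ε) :
    ∃ δ, 0 < δ ∧ x ∈ modulusSet ρ ε δ := by
  obtain ⟨δ, hδ, h⟩ := x.2 ε hε
  exact ⟨δ, hδ, fun s t hst hd => (div_le_iff₀ (RClass.pos_sub ρ hst)).1 (h s t hst hd)⟩

/-! ### Compactness from a family of moduli -/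

section Compactness

variable (ρ) in
/-- The functions vanishing at `0` with a prescribed family of moduli, as a subset of the product. -/
def uniformModulus (δ : ℕ → ℝ) : Set (unitInterval → ℝ) :=
  {f | f 0 = 0 ∧ ∀ (m : ℕ) (s t : unitInterval), s < t → (t : ℝ) - s < δ m →
    |f t - f s| ≤ 1 / ((m : ℝ) + 1) * ρ.1 (t - s)}

variable {δ : ℕ → ℝ}

lemma isLittleHolder_of_mem_uniformModulus (hδ : ∀ m, 0 < δ m) {f : unitInterval → ℝ}
    (hf : f ∈ uniformModulus ρ δ) : IsLittleHolder ρ.1 f := by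
  intro ε hε
  obtain ⟨m, hm⟩ := exists_nat_one_div_lt hε
  refine ⟨δ m, hδ m, fun s t hst hd => ?_⟩
  have hp := RClass.pos_sub ρ hst
  rw [div_le_iff₀ hp]
  exact (hf.2 m s t hst hd).trans (by gcongr)

lemma abs_sub_le_of_mem_uniformModulus {f : unitInterval → ℝ} (hf : f ∈ uniformModulus ρ δ)
    (m : ℕ) {s t : unitInterval} (hd : dist s t < δ m) :
    |f t - f s| ≤ 1 / ((m : ℝ) + 1) * ρ.1 1 := by
  have hρ1 : 0 < ρ.1 1 := RClass.pos ρ one_pos le_rfl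
  wlog hst : s ≤ t generalizing s t
  · rw [abs_sub_comm]
    exact this (by rwa [dist_comm]) (le_of_not_ge hst)
  rcases hst.eq_or_lt with h | h
  · rw [h, sub_self, abs_zero]; positivity
  · have h' : (s : ℝ) < t := h
    have hle : ρ.1 ((t : ℝ) - s) ≤ ρ.1 1 :=
      RClass.mono ρ (by linarith) (by linarith [t.2.2, s.2.1]) le_rfl
    rw [Subtype.dist_eq, Real.dist_eq, abs_sub_comm, abs_of_pos (by linarith)] at hd
    exact (hf.2 m s t h hd).trans (by gcongr)

/-- Walk from 0 to t in steps of length at most δ 0 / 2: each costs at most ρ(1), and the number of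
steps does not depend on f. -/
lemma exists_abs_le_of_mem_uniformModulus (hδ : ∀ m, 0 < δ m) :
    ∃ C : ℝ, ∀ f ∈ uniformModulus ρ δ, ∀ t, |f t| ≤ C := by
  have hd : 0 < δ 0 / 2 := half_pos (hδ 0)
  have key : ∀ f ∈ uniformModulus ρ δ, ∀ (k : ℕ) (t : unitInterval), (t : ℝ) ≤ k * (δ 0 / 2) →
      |f t| ≤ k * ρ.1 1 := by
    intro f hf k
    induction k with
    | zero =>
      intro t ht
      have : t = 0 := Subtype.ext (le_antisymm (by simpa using ht) t.2.1)
      simp [this, hf.1]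
    | succ k ih =>
      intro t ht
      set s : unitInterval := Set.projIcc 0 1 zero_le_one ((t : ℝ) - δ 0 / 2) with hs
      have hsv : (s : ℝ) = max 0 (min 1 ((t : ℝ) - δ 0 / 2)) := rfl
      have ht0 := t.2.1
      have ht1 := t.2.2
      rw [min_eq_right (by linarith)] at hsv
      push_cast at ht
      have hsk : (s : ℝ) ≤ k * (δ 0 / 2) := by
        rw [hsv]; exact max_le (by positivity) (by linarith)
      have hst : dist s t < δ 0 := by
        rw [Subtype.dist_eq, Real.dist_eq, hsv, abs_lt]
        constructor
        · linarith [le_max_right 0 ((t : ℝ) - δ 0 / 2)]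
        · have : max 0 ((t : ℝ) - δ 0 / 2) ≤ t := max_le ht0 (by linarith)
          linarith
      have h1 := abs_sub_le_of_mem_uniformModulus hf 0 hst
      have h2 := ih s hsk
      have h3 := abs_sub_abs_le_abs_sub (f t) (f s)
      push_cast at h1 ⊢
      norm_num at h1
      linarith
  obtain ⟨k, hk⟩ := exists_nat_ge (1 / (δ 0 / 2))
  rw [div_le_iff₀ hd] at hk
  exact ⟨k * ρ.1 1, fun f hf t => key f hf k t (t.2.2.trans hk)⟩

/-- By Tychonoff: the set is pointwise closed inside a product of copies of [-C, C]. -/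
lemma isCompact_uniformModulus (hδ : ∀ m, 0 < δ m) : IsCompact (uniformModulus ρ δ) := by
  obtain ⟨C, hC⟩ := exists_abs_le_of_mem_uniformModulus (ρ := ρ) hδ
  refine (isCompact_univ_pi fun _ : unitInterval => isCompact_Icc (a := -C) (b := C)).of_isClosed_subset
    ?_ fun f hf t _ => abs_le.1 (hC f hf t)
  simp only [uniformModulus, Set.ofPred_and, Set.ofPred_forall]
  refine (isClosed_eq (_root_.continuous_apply 0) continuous_const).inter
    (isClosed_iInter fun m => isClosed_iInter fun s => isClosed_iInter fun t =>
      isClosed_iInter fun _ => isClosed_iInter fun _ => isClosed_le ?_ continuous_const)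
  fun_prop

/-- On the functions with given moduli, the Hölder norm does not refine pointwise convergence. -/
lemma continuous_mk_uniformModulus (hδ : ∀ m, 0 < δ m) :
    Continuous fun f : uniformModulus ρ δ =>
      (mk f.1 (isLittleHolder_of_mem_uniformModulus hδ f.2) : LittleHolder ρ) := by
  have hρ1 : 0 < ρ.1 1 := RClass.pos ρ one_pos le_rfl
  refine continuous_iff_continuousAt.2 fun f₀ => Metric.tendsto_nhds.2 fun ε hε => ?_
  -- For pairs closer than δ m, each function contributes at most ε/4 to the quotient. For the
  -- others ρ(t - s) ≥ ρ(d), so uniform closeness within τ = ε/4 · ρ(d) suffices.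
  obtain ⟨m, hm⟩ := exists_nat_one_div_lt (show 0 < ε / 4 by positivity)
  set d := min (δ m) 1 with hd
  have hd0 : 0 < d := lt_min (hδ m) one_pos
  have hρd : 0 < ρ.1 d := RClass.pos ρ hd0 (min_le_right _ _)
  set τ := ε / 4 * ρ.1 d with hτ
  have hτ0 : 0 < τ := by positivity
  -- Both functions oscillate by at most τ/4 at distance below δ l, so closeness within τ/2 on a
  -- finite δ l-net gives τ everywhere.
  obtain ⟨l, hl⟩ := exists_nat_one_div_lt (show 0 < τ / 4 / ρ.1 1 by positivity)
  rw [lt_div_iff₀ hρ1] at hl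
  obtain ⟨F, -, hF, hcov⟩ := finite_cover_balls_of_compact
    (isCompact_univ (X := unitInterval)) (hδ l)
  have hev : ∀ᶠ f : uniformModulus ρ δ in 𝓝 f₀, ∀ p ∈ F, |f.1 p - f₀.1 p| < τ / 2 := by
    refine (eventually_all_finite hF).2 fun p _ => ?_
    have hc : Continuous fun f : uniformModulus ρ δ => f.1 p :=
      (_root_.continuous_apply p).comp continuous_subtype_val
    exact Metric.tendsto_nhds.1 (hc.tendsto f₀) (τ / 2) (by positivity)
  filter_upwards [hev] with f hf
  have hsup : ∀ t, |f.1 t - f₀.1 t| ≤ τ := by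
    intro t
    obtain ⟨p, hp, htp⟩ := Set.mem_iUnion₂.1 (hcov (Set.mem_univ t))
    have h1 := abs_sub_le_of_mem_uniformModulus f.2 l (s := p) (t := t) (by rwa [dist_comm])
    have h2 := abs_sub_le_of_mem_uniformModulus f₀.2 l (s := p) (t := t) (by rwa [dist_comm])
    have h3 := hf p hp
    rw [abs_le] at *
    rw [abs_lt] at h3
    constructor <;> linarith [h1.1, h1.2, h2.1, h2.2, h3.1, h3.2]
  rw [dist_eq_norm]
  refine (norm_le (A := ε / 2) (by positivity) ?_ ?_).trans_lt (by linarith)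
  · rw [sub_apply, mk_apply, mk_apply, f.2.1, f₀.2.1, sub_zero]
  intro s t hst
  have hst' : (s : ℝ) < t := hst
  have hp := RClass.pos_sub ρ hst
  simp only [sub_apply, mk_apply]
  rcases lt_or_ge ((t : ℝ) - s) (δ m) with h | h
  · have h1 := f.2.2 m s t hst h
    have h2 := f₀.2.2 m s t hst h
    have h3 := mul_le_mul_of_nonneg_right hm.le hp.le
    rw [abs_le] at *
    constructor <;> linarith [h1.1, h1.2, h2.1, h2.2]
  · have h1 := hsup t
    have h2 := hsup s
    have h3 : ρ.1 d ≤ ρ.1 (t - s) :=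
      RClass.mono ρ hd0.le ((min_le_left _ _).trans h) (by linarith [t.2.2, s.2.1])
    have h4 := mul_le_mul_of_nonneg_left h3 (by positivity : 0 ≤ ε / 4)
    rw [abs_le] at *
    constructor <;> linarith [h1.1, h1.2, h2.1, h2.2]

/-- A compactness criterion in the little Hölder space. -/
lemma isCompact_iInter_modulusSet (hδ : ∀ m, 0 < δ m) :
    IsCompact ({x : LittleHolder ρ | x 0 = 0} ∩ ⋂ m : ℕ, modulusSet ρ (1 / ((m : ℝ) + 1)) (δ m)) := by
  have := isCompact_iff_compactSpace.1 (isCompact_uniformModulus (ρ := ρ) hδ)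
  convert isCompact_range (continuous_mk_uniformModulus (ρ := ρ) hδ) using 1
  ext x
  simp only [Set.mem_inter_iff, Set.mem_ofPred_eq, Set.mem_iInter, Set.mem_range]
  constructor
  · rintro ⟨h0, h⟩
    exact ⟨⟨x.1, h0, h⟩, rfl⟩
  · rintro ⟨f, rfl⟩
    exact ⟨f.2.1, f.2.2⟩

end Compactness

/-! ### Tightness from uniform moduli -/

section Tightness

variable {ι : Type*} (ν : ι → Measure (LittleHolder ρ))

/-- The allowed mass η is split into a summable family, one share for each modulus 1/(m + 1); a
union bound controls the complement of the compact intersection. -/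
lemma isTightMeasureSet_of_modulusSet
    (h0 : ∀ n, ν n {x | x 0 = 0}ᶜ = 0)
    (h : ∀ ε : ℝ, 0 < ε → ∀ η : ENNReal, 0 < η → ∃ δ, 0 < δ ∧ ∀ n, ν n (modulusSet ρ ε δ)ᶜ ≤ η) :
    IsTightMeasureSet (Set.range ν) := by
  rw [isTightMeasureSet_iff_exists_isCompact_measure_compl_le]
  intro η hη
  obtain ⟨η', hpos, hsum⟩ := ENNReal.exists_pos_sum_of_countable' hη.ne' ℕ
  choose δ hδ hν using fun m : ℕ => h (1 / ((m : ℝ) + 1)) (by positivity) (η' m) (hpos m)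
  refine ⟨_, isCompact_iInter_modulusSet hδ, ?_⟩
  rintro _ ⟨n, rfl⟩
  rw [Set.compl_inter, Set.compl_iInter]
  refine (measure_union_le _ _).trans ?_
  rw [h0, zero_add]
  refine (measure_iUnion_le _).trans (le_trans ?_ hsum.le)
  exact ENNReal.tsum_le_tsum fun m => hν m n

/-- For one finite measure the moduli hold with high probability at a small enough scale. -/
lemma eventually_measure_compl_modulusSet_le (ν : Measure (LittleHolder ρ)) [IsFiniteMeasure ν]
    {ε : ℝ} (hε : 0 < ε) {η : ENNReal} (hη : 0 < η) :
    ∀ᶠ δ in 𝓝[>] 0, ν (modulusSet ρ ε δ)ᶜ ≤ η := by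
  have hanti : Antitone fun k : ℕ => (modulusSet ρ ε (1 / ((k : ℝ) + 1)))ᶜ := fun k l hkl =>
    Set.compl_subset_compl.2 (modulusSet_anti ε (by gcongr))
  -- The little-o condition is what makes the decreasing complements have empty intersection.
  have hempty : ⋂ k : ℕ, (modulusSet ρ ε (1 / ((k : ℝ) + 1)))ᶜ = ∅ := by
    rw [← Set.compl_iUnion, Set.compl_empty_iff, Set.eq_univ_iff_forall]
    intro x
    obtain ⟨δ, hδ, hx⟩ := exists_mem_modulusSet x hε
    obtain ⟨k, hk⟩ := exists_nat_one_div_lt hδ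
    exact Set.mem_iUnion.2 ⟨k, modulusSet_anti ε hk.le hx⟩
  have hlim := tendsto_measure_iInter_atTop (μ := ν)
    (fun k : ℕ =>
      (isClosed_modulusSet (ρ := ρ) ε (1 / ((k : ℝ) + 1))).measurableSet.compl.nullMeasurableSet)
    hanti ⟨0, measure_ne_top _ _⟩
  rw [hempty, measure_empty] at hlim
  obtain ⟨k, hk⟩ := (hlim.eventually_lt_const hη).exists
  filter_upwards [Ioc_mem_nhdsGT (show (0 : ℝ) < 1 / ((k : ℝ) + 1) by positivity)] with δ hδ
  exact (measure_mono (Set.compl_subset_compl.2 (modulusSet_anti ε hδ.2))).trans hk.le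

end Tightness

end LittleHolder

/-! ### The polygonal process as a random element -/

namespace LittleHolder

variable {i : ℕ}

/-- The ramp `t ↦ 0 ∨ (1 ∧ (n t - j))`, as an element of the little Hölder space. -/
noncomputable def ramp (ρ : RClass i) (n j : ℕ) : LittleHolder ρ :=
  mk (fun t => max 0 (min 1 ((n : ℝ) * t - j))) <|
    isLittleHolder_of_lipschitz ρ (C := n) fun s t hst => by
      have hst' : (s : ℝ) < t := hst
      refine (interpolatedSum.abs_ramp_sub_le j (n * s) (n * t)).trans_eq ?_
      rw [← mul_sub, abs_of_nonneg (mul_nonneg n.cast_nonneg (by linarith))]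

/-- The linear combination of the first `n` ramps with coefficients `v`. -/
noncomputable def rampSum (ρ : RClass i) (n : ℕ) (v : Fin n → ℝ) : LittleHolder ρ :=
  ∑ j : Fin n, v j • ramp ρ n j

lemma rampSum_apply (ρ : RClass i) (n : ℕ) (v : Fin n → ℝ) (t : unitInterval) :
    rampSum ρ n v t = ∑ j : Fin n, v j * max 0 (min 1 ((n : ℝ) * t - (j : ℕ))) := by
  let e : LittleHolder ρ →+ ℝ :=
    { toFun := fun x => x t, map_zero' := rfl, map_add' := fun x y => rfl }
  exact map_sum e _ _

lemma continuous_rampSum (ρ : RClass i) (n : ℕ) : Continuous (rampSum ρ n) := by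
  unfold rampSum
  fun_prop

end LittleHolder

section Polygonal

variable {Ω : Type*} (X : ℕ → Ω → ℝ) (a : ℕ → ℝ) (n : ℕ) (ω : Ω)

lemma polygonalProcess_eq (t : unitInterval) :
    polygonalProcess X a n ω t = 1 / a n * interpolatedSum (fun j => X j ω) (n * t) := rfl

lemma rampSum_apply_eq_polygonalProcess {i : ℕ} (ρ : RClass i) (t : unitInterval) :
    LittleHolder.rampSum ρ n (fun j => 1 / a n * X (j + 1) ω) t = polygonalProcess X a n ω t := by
  have h0 : 0 ≤ (n : ℝ) * t := mul_nonneg n.cast_nonneg t.2.1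
  have h1 : (n : ℝ) * t ≤ n := mul_le_of_le_one_right n.cast_nonneg t.2.2
  rw [LittleHolder.rampSum_apply, polygonalProcess_eq, interpolatedSum.eq_sum_ramp _ n h0 h1,
    ← Fin.sum_univ_eq_sum_range
      (fun j => X (j + 1) ω * max 0 (min 1 ((n : ℝ) * t - (j : ℝ)))), Finset.mul_sum]
  exact Finset.sum_congr rfl fun j _ => mul_assoc _ _ _

lemma polygonalProcess_isLittleHolder {i : ℕ} (ρ : RClass i) :
    IsLittleHolder ρ.1 (polygonalProcess X a n ω) := by
  rw [← funext (rampSum_apply_eq_polygonalProcess X a n ω ρ)]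
  exact (LittleHolder.rampSum ρ n _).2

/-- The polygonal process as a random element of the little Hölder space. -/
noncomputable def polygonalElement {i : ℕ} (ρ : RClass i) : LittleHolder ρ :=
  LittleHolder.mk (polygonalProcess X a n ω) (polygonalProcess_isLittleHolder X a n ω ρ)

lemma polygonalElement_apply {i : ℕ} (ρ : RClass i) (t : unitInterval) :
    polygonalElement X a n ω ρ t = 1 / a n * interpolatedSum (fun j => X j ω) (n * t) := rfl

/-- The process is a continuous image of the random vector of its n coefficients, so Borel
measurability follows without showing that evaluations generate the σ-algebra. -/
lemma measurable_polygonalElement [MeasurableSpace Ω] (hX : ∀ j, 1 ≤ j → Measurable (X j))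
    {i : ℕ} (ρ : RClass i) : Measurable fun ω => polygonalElement X a n ω ρ := by
  have e : (fun ω => polygonalElement X a n ω ρ)
      = LittleHolder.rampSum ρ n ∘ fun ω (j : Fin n) => 1 / a n * X (j + 1) ω :=
    funext fun ω => LittleHolder.ext fun t => (rampSum_apply_eq_polygonalProcess X a n ω ρ t).symm
  rw [e]
  exact (LittleHolder.continuous_rampSum ρ n).measurable.comp
    (measurable_pi_lambda _ fun j => (hX _ (by omega)).const_mul _)

lemma polygonalProcess_zero : polygonalProcess X a n ω 0 = 0 := by
  simp [polygonalProcess, partialSum]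

lemma two_pow_mul_div {p j : ℕ} (h : j ≤ p) (k : ℕ) :
    (2 : ℝ) ^ p * ((k : ℝ) / 2 ^ j) = ((2 ^ (p - j) * k : ℕ) : ℝ) := by
  obtain ⟨l, rfl⟩ := Nat.exists_eq_add_of_le h
  rw [Nat.add_sub_cancel_left, pow_add]
  push_cast
  field_simp

/-- Off the exceptional dyadic events at the dyadic time `2 ^ p`, the process at any comparable time
`n ≤ 2 ^ p` has modulus of continuity `ε * ρ`. -/
lemma polygonalElement_mem_modulusSet {i : ℕ} {ρ : RClass i} {C R ε : ℝ} {J p : ℕ}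
    (hC : 0 < C) (hR : 0 < R) (hε : 0 < ε)
    (hchain : ∀ (x : ℕ → ℝ) (D : ℝ), 0 ≤ D →
      (∀ j, J ≤ j → j ≤ p → ∀ k < 2 ^ j,
        |interpolatedSum x (2 ^ p * (((k + 1 : ℕ) : ℝ) / 2 ^ j))
          - interpolatedSum x (2 ^ p * ((k : ℝ) / 2 ^ j))| ≤ D * ρ.1 ((2 ^ j)⁻¹)) →
      ∀ s t : ℝ, 0 ≤ s → s < t → t ≤ 1 → t - s < (2 ^ J)⁻¹ →
        |interpolatedSum x (2 ^ p * t) - interpolatedSum x (2 ^ p * s)| ≤ C * D * ρ.1 (t - s))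
    (hn : 1 ≤ n) (hnp : n ≤ 2 ^ p) (han : 0 < a n) (haN : 0 ≤ a (2 ^ p)) (haR : a (2 ^ p) ≤ R * a n)
    (hω : ∀ j, J ≤ j → j ≤ p → ∀ k < 2 ^ j,
      |partialSum X (2 ^ (p - j) * (k + 1)) ω - partialSum X (2 ^ (p - j) * k) ω|
        ≤ a (2 ^ p) * (ε / (C * R)) * ρ.1 ((2 ^ j)⁻¹)) :
    polygonalElement X a n ω ρ ∈ LittleHolder.modulusSet ρ ε (2 ^ J)⁻¹ := by
  intro s t hst hd
  have hst' : (s : ℝ) < t := hst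
  have hn0 : (0 : ℝ) < n := by exact_mod_cast hn
  have hN0 : (0 : ℝ) < 2 ^ p := by positivity
  have hr1 : (n : ℝ) / 2 ^ p ≤ 1 := by
    rw [div_le_one hN0]; exact_mod_cast hnp
  have hr0 : 0 < (n : ℝ) / 2 ^ p := by positivity
  set r := (n : ℝ) / 2 ^ p with hr
  have hnr : ∀ u : ℝ, (n : ℝ) * u = 2 ^ p * (r * u) := fun u => by rw [hr]; field_simp
  have hdiff : r * t - r * s ≤ t - s := by
    rw [← mul_sub]; exact mul_le_of_le_one_left (by linarith) hr1
  have hlt : r * (s : ℝ) < r * t := mul_lt_mul_of_pos_left hst' hr0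
  -- The time change u ↦ r u only shrinks distances. The level ε/(C R) cancels the chaining constant
  -- C and the loss R in a(2^p) ≤ R a(n).
  have key := hchain (fun j => X j ω) (a (2 ^ p) * (ε / (C * R))) (by positivity) ?_
    (r * s) (r * t) (mul_nonneg hr0.le s.2.1) hlt (mul_le_one₀ hr1 t.2.1 t.2.2)
    (hdiff.trans_lt hd)
  · rw [← hnr, ← hnr] at key
    have hρle : ρ.1 (r * t - r * s) ≤ ρ.1 (t - s) :=
      RClass.mono ρ (by linarith) hdiff (by linarith [t.2.2, s.2.1])
    have hρ0 : 0 ≤ ρ.1 (r * t - r * s) :=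
      (RClass.pos ρ (by linarith) (by linarith [t.2.2, s.2.1])).le
    rw [polygonalElement_apply, polygonalElement_apply, ← mul_sub, abs_mul, abs_of_pos (by positivity),
      one_div, inv_mul_le_iff₀ han]
    calc _ ≤ C * (a (2 ^ p) * (ε / (C * R))) * ρ.1 (r * t - r * s) := key
      _ ≤ C * ((R * a n) * (ε / (C * R))) * ρ.1 (t - s) := by gcongr
      _ = a n * (ε * ρ.1 (t - s)) := by field_simp
  · intro j hJj hjp k hk
    rw [two_pow_mul_div hjp, two_pow_mul_div hjp, interpolatedSum.natCast, interpolatedSum.natCast]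
    exact hω j hJj hjp k hk

end Polygonal

/-! ### The dyadic criterion and the conclusion -/

lemma floor_two_pow_mul_zpow {p j : ℕ} (h : j ≤ p) (k : ℕ) :
    ⌊((2 ^ p : ℕ) : ℝ) * k * (2 : ℝ) ^ (-(j : ℤ))⌋₊ = 2 ^ (p - j) * k := by
  have e : ((2 ^ p : ℕ) : ℝ) * k * (2 : ℝ) ^ (-(j : ℤ)) = ((2 ^ (p - j) * k : ℕ) : ℝ) := by
    rw [← two_pow_mul_div h, zpow_neg, zpow_natCast]
    push_cast
    ring
  rw [e, Nat.floor_natCast]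

lemma floor_logb_two_pow (p : ℕ) : ⌊Real.logb 2 ((2 ^ p : ℕ) : ℝ)⌋₊ = p := by
  rw [Nat.cast_pow, Nat.cast_ofNat, Real.logb_pow, Real.logb_self_eq_one one_lt_two, mul_one,
    Nat.floor_natCast]

/-- Under the dyadic criterion the processes with large index share a modulus of continuity with high
probability. -/
lemma eventually_measure_polygonalElement_notMem_le {Ω : Type*} [MeasurableSpace Ω] (μ : Measure Ω)
    (X : ℕ → Ω → ℝ) (a : ℕ → ℝ) (ha_mono : MonotoneOn a (Set.Ici 1)) (ha_top : Tendsto a atTop atTop)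
    (ha_ratio : BddAbove ((fun n => a (2 * n) / a n) '' Set.Ici 1)) {i : ℕ} (ρ : RClass i)
    (hcrit : ∀ ε : ℝ, 0 < ε →
      Tendsto (fun J : ℕ => limsup (fun n : ℕ =>
          ∑ j ∈ Finset.Icc J ⌊Real.logb 2 n⌋₊, ∑ k ∈ Finset.range (2 ^ j),
            μ {ω | a n * ε * ρ.1 ((2 : ℝ) ^ (-(j : ℤ))) <
              |partialSum X ⌊(n : ℝ) * (k + 1) * (2 : ℝ) ^ (-(j : ℤ))⌋₊ ω
                - partialSum X ⌊(n : ℝ) * k * (2 : ℝ) ^ (-(j : ℤ))⌋₊ ω|}) atTop)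
        atTop (𝓝 0)) {ε : ℝ} (hε : 0 < ε) {η : ENNReal} (hη : 0 < η) :
    ∃ δ : ℝ, 0 < δ ∧ ∃ n₀ : ℕ, ∀ n, n₀ ≤ n →
      μ {ω | polygonalElement X a n ω ρ ∉ LittleHolder.modulusSet ρ ε δ} ≤ η := by
  obtain ⟨C, hC, M, hchain⟩ := RClass.exists_chaining_constant ρ
  obtain ⟨R₀, hR₀⟩ := ha_ratio
  set R := max R₀ 1 with hRdef
  have hR : 0 < R := lt_max_of_lt_right one_pos
  have hε' : 0 < ε / (C * R) := by positivity
  obtain ⟨J, hJlim, hMJ⟩ :=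
    (((hcrit _ hε').eventually_lt_const hη).and (eventually_ge_atTop M)).exists
  obtain ⟨n₁, hn₁⟩ := eventually_atTop.1
    ((eventually_lt_of_limsup_lt hJlim).and (ha_top.eventually_gt_atTop 0))
  refine ⟨(2 ^ J)⁻¹, by positivity, max n₁ (2 ^ J), fun n hn => ?_⟩
  have hnn₁ : n₁ ≤ n := (le_max_left _ _).trans hn
  have hnJ : 2 ^ J ≤ n := (le_max_right _ _).trans hn
  have hn1 : 1 ≤ n := Nat.one_le_two_pow.trans hnJ
  -- The upper bound 2n means that a single use of the doubling condition compares a(2^p) with a(n).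
  obtain ⟨p, hp1, hp2⟩ : ∃ p, n ≤ 2 ^ p ∧ 2 ^ p ≤ 2 * n := by
    refine ⟨Nat.log 2 n + 1, (Nat.lt_pow_succ_log_self one_lt_two n).le, ?_⟩
    rw [pow_succ']
    exact Nat.mul_le_mul_left 2 (Nat.pow_log_le_self 2 (by omega))
  have hJp : J ≤ p := (Nat.pow_le_pow_iff_right one_lt_two).1 (hnJ.trans hp1)
  have han := (hn₁ n hnn₁).2
  obtain ⟨hsum, haN⟩ := hn₁ (2 ^ p) (hnn₁.trans hp1)
  have haR : a (2 ^ p) ≤ R * a n := by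
    have h1 : a (2 ^ p) ≤ a (2 * n) :=
      ha_mono (Set.mem_Ici.2 (hn1.trans hp1)) (Set.mem_Ici.2 (by omega)) hp2
    have h2 : a (2 * n) / a n ≤ R := (hR₀ ⟨n, hn1, rfl⟩).trans (le_max_left _ _)
    rw [div_le_iff₀ han] at h2
    exact h1.trans h2
  -- At the index 2^p the sum runs over exactly the levels J, …, p needed for chaining.
  rw [floor_logb_two_pow] at hsum
  refine le_trans ?_ hsum.le
  refine le_trans (measure_mono ?_) ((measure_biUnion_finset_le (Finset.Icc J p) _).trans
    (Finset.sum_le_sum fun j _ => measure_biUnion_finset_le (Finset.range (2 ^ j)) _))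
  intro ω hω
  by_contra hnot
  refine hω (polygonalElement_mem_modulusSet X a n ω hC hR hε
    (fun x D hD => hchain x D J p hD hMJ hJp) hn1 hp1 han haN.le haR fun j hJj hjp k hk => ?_)
  simp only [Set.mem_iUnion, not_exists] at hnot
  have h3 := hnot j (Finset.mem_Icc.2 ⟨hJj, hjp⟩) k (Finset.mem_range.2 hk)
  rw [Set.mem_ofPred_eq, not_lt, floor_two_pow_mul_zpow hjp, zpow_neg, zpow_natCast] at h3
  have h4 := floor_two_pow_mul_zpow hjp (k + 1)
  rw [zpow_neg, zpow_natCast, Nat.cast_add_one] at h4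
  rwa [h4] at h3

theorem mainTheorem7 {Ω : Type*} [MeasurableSpace Ω] (μ : Measure Ω) [IsProbabilityMeasure μ]
    (X : ℕ → Ω → ℝ) (hX : ∀ j, 1 ≤ j → Measurable (X j))
    (a : ℕ → ℝ) (ha_ne : ∀ n, 1 ≤ n → a n ≠ 0) (ha_mono : MonotoneOn a (Set.Ici 1))
    (ha_top : Tendsto a atTop atTop)
    (ha_ratio : BddAbove ((fun n => a (2 * n) / a n) '' Set.Ici 1))
    (i : ℕ) (hi : 1 ≤ i) (ρ : RClass i)
    (hcrit : ∀ ε : ℝ, 0 < ε →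
      Tendsto (fun J : ℕ => limsup (fun n : ℕ =>
          ∑ j ∈ Finset.Icc J ⌊Real.logb 2 n⌋₊, ∑ k ∈ Finset.range (2 ^ j),
            μ {ω | a n * ε * ρ.1 ((2 : ℝ) ^ (-(j : ℤ))) <
              |partialSum X ⌊(n : ℝ) * (k + 1) * (2 : ℝ) ^ (-(j : ℤ))⌋₊ ω
                - partialSum X ⌊(n : ℝ) * k * (2 : ℝ) ^ (-(j : ℤ))⌋₊ ω|}) atTop)
        atTop (𝓝 0)) :
    ∃ hW : ∀ n, 1 ≤ n → ∀ ω, IsLittleHolder ρ.1 (polygonalProcess X a n ω),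
      (∀ n (hn : 1 ≤ n),
        Measurable fun ω => LittleHolder.mk (polygonalProcess X a n ω) (hW n hn ω)) ∧
      IsTightMeasureSet {ν : Measure (LittleHolder ρ) | ∃ (n : ℕ) (hn : 1 ≤ n),
        ν = μ.map fun ω => LittleHolder.mk (polygonalProcess X a n ω) (hW n hn ω)} := by
  have hmeas := fun n => measurable_polygonalElement X a n hX ρ
  refine ⟨fun n _ ω => polygonalProcess_isLittleHolder X a n ω ρ, fun n _ => hmeas n, ?_⟩
  -- Including n = 0 is harmless: that path is identically zero.
  refine IsTightMeasureSet.subset (T := Set.range fun n : ℕ => μ.map fun ω =>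
    polygonalElement X a n ω ρ) ?_ (by rintro _ ⟨n, _, rfl⟩; exact ⟨n, rfl⟩)
  have hprob : ∀ n, IsProbabilityMeasure (μ.map fun ω => polygonalElement X a n ω ρ) :=
    fun n => Measure.isProbabilityMeasure_map (hmeas n).aemeasurable
  refine LittleHolder.isTightMeasureSet_of_modulusSet _ (fun n => ?_) fun ε hε η hη => ?_
  · have hclosed : IsClosed {x : LittleHolder ρ | x 0 = 0} :=
      isClosed_eq (LittleHolder.continuous_apply 0) continuous_const
    rw [Measure.map_apply (hmeas n) hclosed.measurableSet.compl]
    convert measure_empty (μ := μ)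
    exact Set.eq_empty_of_forall_notMem fun ω hω => hω (polygonalProcess_zero X a n ω)
  · obtain ⟨δ₁, hδ₁, n₀, hlarge⟩ := eventually_measure_polygonalElement_notMem_le μ X a ha_mono
      ha_top ha_ratio ρ hcrit hε hη
    -- Each of the finitely many remaining laws has its own scale; a common smaller one serves them
    -- all.
    have hsmall := (eventually_all_finite (Set.finite_lt_nat n₀)).2 fun n _ =>
      LittleHolder.eventually_measure_compl_modulusSet_le
        (μ.map fun ω => polygonalElement X a n ω ρ) hε hη
    obtain ⟨δ, hδ, hδpos, hδle⟩ := (hsmall.and (Ioc_mem_nhdsGT hδ₁)).exists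
    refine ⟨δ, hδpos, fun n => ?_⟩
    rcases lt_or_ge n n₀ with h | h
    · exact hδ n h
    · refine (measure_mono (Set.compl_subset_compl.2
        (LittleHolder.modulusSet_anti ε hδle))).trans ?_
      rw [Measure.map_apply (hmeas n) (LittleHolder.isClosed_modulusSet ε δ₁).measurableSet.compl]
      exact hlarge n h
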